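/- Let $Z$ be a smooth real Banach manifold and $\Pi\colon D\to Z$ a smooth vector bundle whose typical fibre is a complex Banach space, with a Hermitian structure: for each $z\in Z$ a sesquilinear form $(\cdot\mid\cdot)_z$ on $D_z$ (linear in the first variable) with $\overline{(\xi\mid\eta)_z}=(\eta\mid\xi)_z$, such that $\eta\mapsto(\cdot\mid\eta)_z$ is an isomorphism of the complex conjugate of $D_z$ onto the dual of $D_z$, and such that the forms depend smoothly on $z$ in local trivializations. (Positive definiteness of the forms is not required.) A reproducing kernel on $\Pi$ is a family $K=(K(s,t))_{s,t\in Z}$ of bounded linear operators $K(s,t)\colon D_t\to D_s$ such that $\sum_{j,l=1}^n (K(t_l,t_j)\eta_j\mid\eta_l)_{t_l}\ge 0$ for all $n$, $t_j\in Z$ and $\eta_j\in D_{t_j}$. For $\xi\in D_s$ let $K_\xi$ be the section $K(\cdot,s)\xi$ of $\Pi$, and let $\mathcal H^K$ be the Hilbert space completion of $\operatorname{span}\{K_\xi\mid \xi\in D\}$ for the scalar product with $(K_\eta\mid K_\xi)=(K(s,t)\eta\mid\xi)_s$ when $\xi\in D_s$, $\eta\in D_t$. For a complex Hilbert space $\mathcal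 H$, let $\operatorname{Gr}(\mathcal H)$ be the set of closed linear subspaces of $\mathcal H$, let $\Pi_{\mathcal H}\colon \{(\mathcal S,x)\mid x\in\mathcal S\}\to\operatorname{Gr}(\mathcal H)$ be the tautological bundle, with the scalar product of $\mathcal H$ on each fibre $\mathcal S$, and let $Q_{\mathcal H}(\mathcal S_1,\mathcal S_2)=p_{\mathcal S_1}|_{\mathcal S_2}\colon\mathcal S_2\to\mathcal S_1$ be its universal kernel, where $p_{\mathcal S}$ is the orthogonal projection of $\mathcal H$ onto $\mathcal S$. A bundle homomorphism $\Delta=(\delta,\zeta)$ from $\Pi$ to $\Pi_{\mathcal H}$ is a map $\zeta\colon Z\to\operatorname{Gr}(\mathcal H)$ together with bounded linear maps $\delta_s\colon D_s\to\zeta(s)$, $s\in Z$ (no continuity in $s$ is required), and the pull-back of $Q_{\mathcal H}$ by $\Delta$ is $(\Delta^*Q_{\mathcal H})(s,t)=\delta_s^{*}\circ Q_{\mathcal H}(\zeta(s),\zeta(t))\circ\delta_t$, where $\delta_s^*\colon\zeta(s)\to D_s$ is given by $(\delta_s\xi\mid x)_{\mathcal H}=(\xi\mid\delta_s^*x)_s$.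 **Theorem.** For every reproducing kernel $K$ on $\Pi$ there is a bundle homomorphism $\Delta_K=(\delta_K,\zeta_K)$ from $\Pi$ into the tautological bundle $\Pi_{\mathcal H^K}$, given by $\zeta_K(s)=\overline{\{K_\xi\mid\xi\in D_s\}}$ and $\delta_K(\xi)=(\zeta_K(s),K_\xi)$ for $\xi\in D_s$, such that $K=(\Delta_K)^*Q_{\mathcal H^K}$. In particular, let $X$ be any set and $k\colon X\times X\to\mathbb C$ a classical (positive definite) scalar kernel, viewed as the kernel on the trivial line bundle $X\times\mathbb C\to X$ (with $(x\mid y)=x\overline y$) for which $K(s,t)$ is multiplication by $k(s,t)$. If its reproducing kernel Hilbert space is separable, then this kernel is the pull-back of $Q_{\ell^2(\mathbb N)}$ by some bundle homomorphism from $X\times\mathbb C\to X$ into $\Pi_{\ell^2(\mathbb N)}$. -/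

import Mathlib

open Bundle
open scoped Manifold ContDiff ComplexOrder ComplexConjugate

/-! ### Hermitian bundles -/

/-- A Hermitian strong duality pairing on every fibre of a family `D` of complex topological
vector spaces. The field `toDual z` is the map `η ↦ (· | η)_z`; that it is an isomorphism of
topological vector spaces from the complex conjugate of `D z` onto the dual of `D z` is the
strong duality. The companion statement for `ξ ↦ (ξ | ·)_z` follows from the symmetry.
The pairing is not required to be positive definite. -/
structure HermitianForm {Z : Type*} (D : Z → Type*)
    [∀ z, AddCommGroup (D z)] [∀ z, Module ℂ (D z)] [∀ z, TopologicalSpace (D z)] where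
  toDual : ∀ z, D z ≃L⋆[ℂ] (D z →L[ℂ] ℂ)
  conj_symm : ∀ (z : Z) (ξ η : D z), conj (toDual z η ξ) = toDual z ξ η

namespace HermitianForm

variable {Z : Type*} {D : Z → Type*}
  [∀ z, AddCommGroup (D z)] [∀ z, Module ℂ (D z)] [∀ z, TopologicalSpace (D z)]

/-- The pairing `(ξ | η)_z`, linear in `ξ` and antilinear in `η`. -/
noncomputable def form (h : HermitianForm D) {z : Z} (ξ η : D z) : ℂ := h.toDual z η ξ

variable (h : HermitianForm D) {z : Z}

theorem conj_form (ξ η : D z) : conj (h.form ξ η) = h.form η ξ := h.conj_symm z ξ η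

theorem form_add_left (ξ ξ' η : D z) : h.form (ξ + ξ') η = h.form ξ η + h.form ξ' η := by
  simp [form]

theorem form_smul_left (c : ℂ) (ξ η : D z) : h.form (c • ξ) η = c * h.form ξ η := by
  simp [form]

theorem form_add_right (ξ η η' : D z) : h.form ξ (η + η') = h.form ξ η + h.form ξ η' := by
  simp [form]

theorem form_smul_right (c : ℂ) (ξ η : D z) : h.form ξ (c • η) = conj c * h.form ξ η := by
  simp [form]

theorem form_zero_left (η : D z) : h.form 0 η = 0 := by simp [form]

theorem form_sum_left {ι : Type*} (s : Finset ι) (f : ι → D z) (η : D z) :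
    h.form (∑ i ∈ s, f i) η = ∑ i ∈ s, h.form (f i) η := by
  simp [form]

theorem eq_zero_of_form (ξ : D z) (hξ : ∀ η, h.form ξ η = 0) : ξ = 0 := by
  have : h.toDual z ξ = 0 := by
    ext η
    have := congrArg conj (hξ η)
    rwa [conj_form, map_zero] at this
  simpa using this

end HermitianForm

/-- The standard Hermitian form on a family of Hilbert spaces:
`(x | y)_z` is the scalar product of `x` and `y`. -/
noncomputable def HermitianForm.ofHilbert {Z : Type*} (E : Z → Type*)
    [∀ z, NormedAddCommGroup (E z)] [∀ z, InnerProductSpace ℂ (E z)]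
    [∀ z, CompleteSpace (E z)] : HermitianForm E where
  toDual z := (InnerProductSpace.toDual ℂ (E z)).toContinuousLinearEquiv
  conj_symm z ξ η := by
    change conj (inner ℂ η ξ) = inner ℂ ξ η
    exact inner_conj_symm ξ η

/-- A complex vector bundle is a real vector bundle with the same trivializations. -/
instance VectorBundle.realOfComplex {Z : Type*} [TopologicalSpace Z]
    (F : Type*) [NormedAddCommGroup F] [NormedSpace ℂ F]
    (D : Z → Type*) [∀ z, AddCommGroup (D z)] [∀ z, Module ℂ (D z)]
    [TopologicalSpace (TotalSpace F D)] [∀ z, TopologicalSpace (D z)]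
    [FiberBundle F D] [VectorBundle ℂ F D] : VectorBundle ℝ F D := by
  have lin : ∀ (e : Trivialization F (π F D)) [MemTrivializationAtlas e], e.IsLinear ℝ := by
    intro e _
    refine ⟨fun b hb => ?_⟩
    have := e.linear ℂ hb
    exact ⟨this.map_add, fun c x => by
      have := this.map_smul (c : ℂ) x
      simpa using this⟩
  refine ⟨lin, ?_⟩
  intro e e' _ _
  have := lin e
  have := lin e'
  have hc := continuousOn_coordChange ℂ e e'
  have hr : Continuous (ContinuousLinearMap.restrictScalarsL ℂ F F ℝ ℝ) :=
    ContinuousLinearMap.continuous _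
  refine (hr.comp_continuousOn hc).congr ?_
  intro b hb
  ext y
  change Trivialization.coordChangeL ℝ e e' b y = Trivialization.coordChangeL ℂ e e' b y
  rw [Trivialization.coordChangeL_apply e e' hb, Trivialization.coordChangeL_apply e e' hb]

/-- A Hermitian structure on a vector bundle `D` with typical fibre the complex Banach space `F`
over the real Banach manifold `Z` (with model space `B`): Hermitian strong duality pairings of
the fibres which depend smoothly on the base point in every local trivialization. -/
structure HermitianStructure (B : Type*) [NormedAddCommGroup B] [NormedSpace ℝ B]
    {Z : Type*} [TopologicalSpace Z] [ChartedSpace B Z]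
    (F : Type*) [NormedAddCommGroup F] [NormedSpace ℂ F]
    (D : Z → Type*) [∀ z, AddCommGroup (D z)] [∀ z, Module ℂ (D z)]
    [TopologicalSpace (TotalSpace F D)] [∀ z, TopologicalSpace (D z)]
    [FiberBundle F D] [VectorBundle ℂ F D] extends HermitianForm D where
  smooth : ∀ (e : Trivialization F (π F D)) [MemTrivializationAtlas e],
    ContMDiffOn (𝓘(ℝ, B).prod 𝓘(ℝ, F × F)) 𝓘(ℝ, ℂ) ∞
      (fun p : Z × (F × F) =>
        toHermitianForm.form (e.symm p.1 p.2.1) (e.symm p.1 p.2.2))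
      (e.baseSet ×ˢ Set.univ)

/-! ### Bundle homomorphisms and adjoints -/

/-- An (algebraic) homomorphism `Θ = (δ, ζ)` of bundles of complex topological vector spaces:
a map `ζ` between the bases together with bounded linear maps `δ_z : D_z → D'_{ζ(z)}`.
The map between total spaces is `(z, ξ) ↦ (ζ z, δ_z ξ)`. -/
structure BundleHom {Z Z' : Type*} (D : Z → Type*) (D' : Z' → Type*)
    [∀ z, AddCommGroup (D z)] [∀ z, Module ℂ (D z)] [∀ z, TopologicalSpace (D z)]
    [∀ z, AddCommGroup (D' z)] [∀ z, Module ℂ (D' z)] [∀ z, TopologicalSpace (D' z)] where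
  base : Z → Z'
  fiber : ∀ z, D z →L[ℂ] D' (base z)

section Adjoint

variable {Z Z' : Type*} {D : Z → Type*} {D' : Z' → Type*}
  [∀ z, AddCommGroup (D z)] [∀ z, Module ℂ (D z)] [∀ z, TopologicalSpace (D z)]
  [∀ z, AddCommGroup (D' z)] [∀ z, Module ℂ (D' z)] [∀ z, TopologicalSpace (D' z)]

/-- The adjoint of a bounded linear map between fibres, characterized by
`(T ξ | η) = (ξ | T⁎ η)`. -/
noncomputable def HermitianForm.adjoint (h : HermitianForm D) (h' : HermitianForm D')
    {z : Z} {w : Z'} (T : D z →L[ℂ] D' w) : D' w →L[ℂ] D z :=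
  ((h.toDual z).symm : (D z →L[ℂ] ℂ) →SL[starRingEnd ℂ] D z).comp
    ((ContinuousLinearMap.precomp ℂ T).comp
      (h'.toDual w : D' w →SL[starRingEnd ℂ] (D' w →L[ℂ] ℂ)))

theorem HermitianForm.form_adjoint (h : HermitianForm D) (h' : HermitianForm D')
    {z : Z} {w : Z'} (T : D z →L[ℂ] D' w) (ξ : D z) (η : D' w) :
    h.form ξ (h.adjoint h' T η) = h'.form (T ξ) η := by
  simp [HermitianForm.form, HermitianForm.adjoint]

end Adjoint

/-! ### Reproducing kernels and their pull-backs -/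

/-- A reproducing kernel on a Hermitian bundle: a family of bounded linear maps
`K s t : D_t → D_s` that is positive definite. -/
structure ReproducingKernel {Z : Type*} {D : Z → Type*}
    [∀ z, AddCommGroup (D z)] [∀ z, Module ℂ (D z)] [∀ z, TopologicalSpace (D z)]
    (h : HermitianForm D) where
  op : ∀ s t, D t →L[ℂ] D s
  nonneg : ∀ (n : ℕ) (t : Fin n → Z) (η : ∀ j, D (t j)),
    0 ≤ ∑ j, ∑ l, h.form (op (t l) (t j) (η j)) (η l)

/-- The pull-back `(Θ^* Q)(s, t) = δ_s^* ∘ Q(ζ(s), ζ(t)) ∘ δ_t` of a reproducing kernel. -/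
noncomputable def ReproducingKernel.pullback {Z Z' : Type*} {D : Z → Type*} {D' : Z' → Type*}
    [∀ z, AddCommGroup (D z)] [∀ z, Module ℂ (D z)] [∀ z, TopologicalSpace (D z)]
    [∀ z, AddCommGroup (D' z)] [∀ z, Module ℂ (D' z)] [∀ z, TopologicalSpace (D' z)]
    {h' : HermitianForm D'} (Q : ReproducingKernel h') (h : HermitianForm D)
    (Θ : BundleHom D D') : ReproducingKernel h where
  op s t := (h.adjoint h' (Θ.fiber s)).comp ((Q.op (Θ.base s) (Θ.base t)).comp (Θ.fiber t))
  nonneg n t η := by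
    have key : ∀ j l, h.form ((h.adjoint h' (Θ.fiber (t l)))
        (Q.op (Θ.base (t l)) (Θ.base (t j)) (Θ.fiber (t j) (η j)))) (η l)
        = h'.form (Q.op (Θ.base (t l)) (Θ.base (t j)) (Θ.fiber (t j) (η j)))
          (Θ.fiber (t l) (η l)) := by
      intro j l
      rw [← h.conj_form, h.form_adjoint, h'.conj_form]
    simp only [ContinuousLinearMap.comp_apply, key]
    exact Q.nonneg n (fun j => Θ.base (t j)) (fun j => Θ.fiber (t j) (η j))

/-! ### The reproducing kernel Hilbert space -/

namespace ReproducingKernel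

variable {Z : Type*} {D : Z → Type*}
  [∀ z, AddCommGroup (D z)] [∀ z, Module ℂ (D z)] [∀ z, TopologicalSpace (D z)]
  {h : HermitianForm D} (K : ReproducingKernel h)

/-- `kernelSection s ξ` is the section `K_ξ = K(·, s) ξ`, for `ξ ∈ D_s`. -/
def kernelSection (s : Z) : D s →ₗ[ℂ] (∀ z, D z) where
  toFun ξ := fun z => K.op z s ξ
  map_add' ξ η := by ext z; simp
  map_smul' c ξ := by ext z; simp

/-- The space of sections spanned by the sections `K_ξ`, `ξ ∈ D`. -/
def preSubmodule : Submodule ℂ (∀ z, D z) :=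
  Submodule.span ℂ (Set.range fun p : (Σ z, D z) => K.kernelSection p.1 p.2)

/-- The space `H_0^K`, which will carry the scalar product with
`(K_η | K_ξ) = (K(s, t) η | ξ)_s` for `ξ ∈ D_s`, `η ∈ D_t`. -/
def PreRKHS : Type _ := ↥K.preSubmodule

noncomputable instance : AddCommGroup K.PreRKHS :=
  inferInstanceAs (AddCommGroup ↥K.preSubmodule)

noncomputable instance : Module ℂ K.PreRKHS :=
  inferInstanceAs (Module ℂ ↥K.preSubmodule)

/-- `K_ξ` as an element of `H_0^K`. -/
noncomputable def preFeature (s : Z) : D s →ₗ[ℂ] K.PreRKHS :=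
  (K.kernelSection s).codRestrict K.preSubmodule
    fun ξ => Submodule.subset_span ⟨⟨s, ξ⟩, rfl⟩

/-- The value at `z` of an element of `H_0^K`, which is a section. -/
noncomputable def eval (z : Z) : K.PreRKHS →ₗ[ℂ] D z :=
  (LinearMap.proj z).comp K.preSubmodule.subtype

theorem eval_preFeature (z s : Z) (ξ : D s) : K.eval z (K.preFeature s ξ) = K.op z s ξ := rfl

theorem eval_ext {f : K.PreRKHS} (hf : ∀ z, K.eval z f = 0) : f = 0 :=
  Subtype.ext (funext hf)

/-- Hermitian symmetry of the kernel. -/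
theorem form_op_symm (s t : Z) (ξ : D s) (η : D t) :
    conj (h.form (K.op s t η) ξ) = h.form (K.op t s ξ) η := by
  have diag : ∀ (r : Z) (ζ : D r), (h.form (K.op r r ζ) ζ).im = 0 := by
    intro r ζ
    have := K.nonneg 1 (fun _ => r) (fun _ => ζ)
    simp only [Fin.sum_univ_one] at this
    exact ((Complex.nonneg_iff.1 this).2).symm
  have two : ∀ (ξ : D s) (η : D t),
      (h.form (K.op s t η) ξ).im + (h.form (K.op t s ξ) η).im = 0 := by
    intro ξ η
    have := K.nonneg 2 (Fin.cons s (Fin.cons t finZeroElim))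
      (Fin.cons ξ (Fin.cons η finZeroElim))
    simp only [Fin.sum_univ_two] at this
    have h2 := ((Complex.nonneg_iff.1 this).2).symm
    simp only [Complex.add_im] at h2
    have a := diag s ξ
    have b := diag t η
    change _ + (h.form (K.op t s ξ) η).im + ((h.form (K.op s t η) ξ).im + _) = 0 at h2
    have c : ∀ x y : ℝ, (h.form (K.op s s ξ) ξ).im + x + (y + (h.form (K.op t t η) η).im) = 0 →
        y + x = 0 := by
      intro x y hxy
      linarith
    exact c _ _ h2
  have h1 := two ξ η
  have h2 := two (Complex.I • ξ) η
  rw [h.form_smul_right, map_smul, h.form_smul_left] at h2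
  simp at h2
  apply Complex.ext
  · rw [Complex.conj_re]; linarith
  · rw [Complex.conj_im]; linarith

/-- Every element of `H_0^K` is a finite linear combination of sections `K_ξ`. -/
theorem exists_repr (f : K.PreRKHS) : ∃ c : (Σ z, D z) →₀ ℂ,
    (c.sum fun p a => a • K.preFeature p.1 p.2) = f := by
  obtain ⟨c, hc⟩ := (Finsupp.mem_span_range_iff_exists_finsupp (R := ℂ)).1 f.2
  refine ⟨c, Subtype.ext ?_⟩
  rw [← hc, Finsupp.sum, Finsupp.sum]
  exact map_sum K.preSubmodule.subtype _ _

/-- The scalar product of `H_0^K`, antilinear in the first variable: if `g = ∑ a_i K_{ξ_i}` with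
`ξ_i ∈ D_{s_i}`, then `⟪g, f⟫ = ∑ conj a_i (f(s_i) | ξ_i)`. -/
noncomputable def preInner (g f : K.PreRKHS) : ℂ :=
  (K.exists_repr g).choose.sum fun p a => conj a * h.form (K.eval p.1 f) p.2

theorem preInner_eq (g f : K.PreRKHS) (c : (Σ z, D z) →₀ ℂ)
    (hc : (c.sum fun p a => a • K.preFeature p.1 p.2) = g) :
    K.preInner g f = c.sum fun p a => conj a * h.form (K.eval p.1 f) p.2 := by
  have main : ∀ c : (Σ z, D z) →₀ ℂ, (c.sum fun p a => a • K.preFeature p.1 p.2) = g →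
      ∀ d : (Σ z, D z) →₀ ℂ, (d.sum fun p a => a • K.preFeature p.1 p.2) = f →
      (c.sum fun p a => conj a * h.form (K.eval p.1 f) p.2)
        = conj (d.sum fun q b => conj b * h.form (K.eval q.1 g) q.2) := by
    intro c hc d hd
    rw [← hc, ← hd]
    simp only [Finsupp.sum, map_sum, map_smul, eval_preFeature, h.form_sum_left,
      h.form_smul_left, Finset.mul_sum, map_mul, Complex.conj_conj, form_op_symm]
    rw [Finset.sum_comm]
    refine Finset.sum_congr rfl fun q _ => Finset.sum_congr rfl fun p _ => ?_
    ring
  obtain ⟨d, hd⟩ := K.exists_repr f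
  rw [preInner, main _ (K.exists_repr g).choose_spec d hd, main c hc d hd]

theorem preInner_preFeature (s : Z) (ξ : D s) (f : K.PreRKHS) :
    K.preInner (K.preFeature s ξ) f = h.form (K.eval s f) ξ := by
  rw [K.preInner_eq _ _ (Finsupp.single ⟨s, ξ⟩ 1) (by simp)]
  simp

theorem preInner_add_right (g f f' : K.PreRKHS) :
    K.preInner g (f + f') = K.preInner g f + K.preInner g f' := by
  simp only [preInner, map_add, h.form_add_left, mul_add, Finsupp.sum, Finset.sum_add_distrib]

theorem preInner_smul_right (g f : K.PreRKHS) (a : ℂ) :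
    K.preInner g (a • f) = a * K.preInner g f := by
  simp only [preInner, map_smul, h.form_smul_left, Finsupp.sum, Finset.mul_sum]
  refine Finset.sum_congr rfl fun p _ => ?_
  ring

theorem preInner_conj (g f : K.PreRKHS) : conj (K.preInner f g) = K.preInner g f := by
  obtain ⟨c, hc⟩ := K.exists_repr g
  obtain ⟨d, hd⟩ := K.exists_repr f
  rw [K.preInner_eq g f c hc, K.preInner_eq f g d hd, ← hc, ← hd]
  simp only [Finsupp.sum, map_sum, map_smul, eval_preFeature, h.form_sum_left,
    h.form_smul_left, Finset.mul_sum, map_mul, Complex.conj_conj, form_op_symm]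
  rw [Finset.sum_comm]
  refine Finset.sum_congr rfl fun q _ => Finset.sum_congr rfl fun p _ => ?_
  ring

theorem preInner_self_nonneg (f : K.PreRKHS) : 0 ≤ K.preInner f f := by
  obtain ⟨c, hc⟩ := K.exists_repr f
  have e := c.support.equivFin.symm
  have := K.nonneg _ (fun j => (e j).1.1) (fun j => c (e j).1 • (e j).1.2)
  refine this.trans_eq ?_
  rw [K.preInner_eq f f c hc]
  conv_rhs => rw [← hc]
  simp only [Finsupp.sum, map_sum, map_smul, eval_preFeature, h.form_sum_left,
    h.form_smul_left, h.form_smul_right, Finset.mul_sum]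
  rw [Finset.sum_comm, ← Finset.sum_coe_sort c.support, ← Equiv.sum_comp e]
  refine Finset.sum_congr rfl fun l _ => ?_
  rw [← Finset.sum_coe_sort c.support, ← Equiv.sum_comp e]
  refine Finset.sum_congr rfl fun j _ => ?_
  ring

theorem preInner_self_eq_zero (f : K.PreRKHS) (hf : K.preInner f f = 0) : f = 0 := by
  let core : PreInnerProductSpace.Core ℂ K.PreRKHS :=
    { inner := K.preInner
      conj_inner_symm := fun x y => K.preInner_conj x y
      re_inner_nonneg := fun x => (Complex.nonneg_iff.1 (K.preInner_self_nonneg x)).1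
      add_left := fun x y z => by
        rw [← K.preInner_conj, K.preInner_add_right, map_add, K.preInner_conj, K.preInner_conj]
      smul_left := fun x y r => by
        rw [← K.preInner_conj, K.preInner_smul_right, map_mul, K.preInner_conj] }
  refine K.eval_ext fun z => h.eq_zero_of_form _ fun η => ?_
  rw [← K.preInner_preFeature]
  have cs := InnerProductSpace.Core.inner_mul_inner_self_le (𝕜 := ℂ) (K.preFeature z η) f
  change ‖K.preInner _ f‖ * ‖K.preInner f _‖ ≤ RCLike.re _ * RCLike.re (K.preInner f f) at cs
  rw [hf, ← K.preInner_conj f, Complex.norm_conj] at cs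
  simp only [map_zero, mul_zero] at cs
  exact norm_eq_zero.1 (mul_self_eq_zero.1 (le_antisymm cs (mul_self_nonneg _)))

/-- The scalar product of `H_0^K`. -/
@[reducible] noncomputable def innerCore : InnerProductSpace.Core ℂ K.PreRKHS where
  inner := K.preInner
  conj_inner_symm x y := K.preInner_conj x y
  re_inner_nonneg x := (Complex.nonneg_iff.1 (K.preInner_self_nonneg x)).1
  add_left x y z := by
    rw [← K.preInner_conj, K.preInner_add_right, map_add, K.preInner_conj, K.preInner_conj]
  smul_left x y r := by
    rw [← K.preInner_conj, K.preInner_smul_right, map_mul, K.preInner_conj]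
  definite := K.preInner_self_eq_zero

noncomputable instance : NormedAddCommGroup K.PreRKHS :=
  K.innerCore.toNormedAddCommGroup

noncomputable instance : InnerProductSpace ℂ K.PreRKHS :=
  InnerProductSpace.ofCore K.innerCore.toCore

/-- The reproducing kernel Hilbert space `H^K`, the completion of `H_0^K`. -/
abbrev RKHS : Type _ := UniformSpace.Completion K.PreRKHS

/-- The restriction to the fibre `D_s` of the map `ξ ↦ K_ξ` from `D` to `H^K`. -/
noncomputable def feature (s : Z) : D s →ₗ[ℂ] K.RKHS :=
  (UniformSpace.Completion.toComplₗᵢ (𝕜 := ℂ) (E := K.PreRKHS)).toLinearMap.comp (K.preFeature s)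

/-- The defining formula of the scalar product: `(K_η | K_ξ) = (K(s, t) η | ξ)_s`. -/
theorem inner_feature (s t : Z) (ξ : D s) (η : D t) :
    inner ℂ (K.feature s ξ) (K.feature t η) = h.form (K.op s t η) ξ := by
  change inner ℂ (K.preFeature s ξ : K.RKHS) (K.preFeature t η : K.RKHS) = _
  rw [UniformSpace.Completion.inner_coe]
  exact K.preInner_preFeature s ξ _

end ReproducingKernel

/-! ### The tautological bundle and its universal kernel -/

section Tautological

variable (H : Type*) [NormedAddCommGroup H] [InnerProductSpace ℂ H]

/-- The fibre over `S` of the tautological bundle over the Grassmannian `ClosedSubmodule ℂ H` of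
all closed linear subspaces of `H`: the Hilbert space `S` itself. -/
abbrev Tautological (S : ClosedSubmodule ℂ H) : Type _ := ↥S.toSubmodule

instance Tautological.completeSpace [CompleteSpace H] (S : ClosedSubmodule ℂ H) :
    CompleteSpace (Tautological H S) :=
  S.isClosed.completeSpace_coe

/-- The Hermitian structure of the tautological bundle, given by the scalar product of `H`. -/
noncomputable abbrev tautologicalForm [CompleteSpace H] : HermitianForm (Tautological H) :=
  HermitianForm.ofHilbert (Tautological H)

/-- The universal kernel: `Q(S₁, S₂)` is the restriction to `S₂` of the orthogonal projection
of `H` onto `S₁`. -/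
noncomputable def universalKernel [CompleteSpace H] :
    ReproducingKernel (tautologicalForm H) where
  op S₁ S₂ := S₁.toSubmodule.orthogonalProjectionOnto.comp S₂.toSubmodule.subtypeL
  nonneg n S x := by
    have key : ∀ j l, (tautologicalForm H).form
        (((S l).toSubmodule.orthogonalProjectionOnto.comp (S j).toSubmodule.subtypeL) (x j)) (x l)
        = inner ℂ (x l : H) (x j : H) := by
      intro j l
      change inner ℂ (x l) ((S l).toSubmodule.orthogonalProjectionOnto (x j : H)) = _
      rw [Submodule.coe_inner]
      exact Submodule.inner_orthogonalProjectionOnto_eq_of_mem_left (x l) (x j : H)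
    have : ∑ j, ∑ l, inner ℂ (x l : H) (x j : H)
        = inner ℂ (∑ l, (x l : H)) (∑ j, (x j : H)) := by
      rw [inner_sum]
      simp only [sum_inner]
    simp only [key, this]
    rw [inner_self_eq_norm_sq_to_K, ← RCLike.ofReal_pow]
    exact Complex.zero_le_real.2 (sq_nonneg _)

end Tautological

/-! ### Classical scalar kernels -/

/-- A classical (scalar) reproducing kernel on a set. -/
def IsPositiveDefiniteKernel {X : Type*} (k : X → X → ℂ) : Prop :=
  ∀ (n : ℕ) (t : Fin n → X) (c : Fin n → ℂ), 0 ≤ ∑ j, ∑ l, k (t l) (t j) * c j * conj (c l)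

/-- The Hermitian structure `(x | y) = x * conj y` of the trivial line bundle `X × ℂ → X`. -/
noncomputable abbrev trivialLineForm (X : Type*) : HermitianForm (fun _ : X => ℂ) :=
  HermitianForm.ofHilbert (fun _ : X => ℂ)

/-- A classical kernel viewed as a reproducing kernel on the trivial line bundle `X × ℂ → X`:
`K(s, t)` is multiplication by `k s t`. -/
noncomputable def IsPositiveDefiniteKernel.toReproducingKernel {X : Type*} {k : X → X → ℂ}
    (hk : IsPositiveDefiniteKernel k) : ReproducingKernel (trivialLineForm X) where
  op s t := k s t • ContinuousLinearMap.id ℂ ℂ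
  nonneg n t c := by
    have key : ∀ j l, (trivialLineForm X).form (z := t l)
        ((k (t l) (t j) • ContinuousLinearMap.id ℂ ℂ) (c j)) (c l)
        = k (t l) (t j) * c j * conj (c l) := by
      intro j l
      change inner ℂ (c l) ((k (t l) (t j) • ContinuousLinearMap.id ℂ ℂ) (c j)) = _
      simp
    have := hk n t c
    simp only [← key] at this
    exact this

/-! The argument is fibrewise and rests on feature maps: bounded linear maps `φ s` from `D s` to a
Hilbert space `H` whose inner products reproduce the kernel, `⟪φ s ξ, φ t η⟫ = (K(s,t)η | ξ)_s`.
Take `ζ(s)` to be the closure of the range of `φ s`. Moving the adjoint across the pairing turns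
`(δ_s^* p_{ζ(s)} φ_t η | ξ)_s` into `⟪φ s ξ, p_{ζ(s)} φ t η⟫`. The projection may be dropped because
`φ s ξ` lies in `ζ(s)`, and what remains is `(K(s,t)η | ξ)_s`. Nondegeneracy of the pairing then
identifies the operators (`eq_pullback_ofFeature`).

For `ξ ↦ K_ξ` the inner product formula is how `H^K` was built, so only boundedness is left; it
follows from `‖K_ξ‖² = (K(s,s)ξ | ξ)_s` and joint continuity of the pairing (`continuous_feature`).

In the scalar case, composing this feature map with an isometry of the separable space `H^K` into
`ℓ²(ℕ)` leaves inner products unchanged, so the same lemma applies with `H = ℓ²(ℕ)`. -/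

/-- A Hermitian strong duality pairing on a normable fibre is jointly continuous. -/
theorem HermitianForm.continuous_form {Z : Type*} {D : Z → Type*}
    [∀ z, AddCommGroup (D z)] [∀ z, Module ℂ (D z)] [∀ z, TopologicalSpace (D z)]
    (h : HermitianForm D) {z : Z} {F : Type*} [NormedAddCommGroup F] [NormedSpace ℂ F]
    (e : D z ≃L[ℂ] F) : Continuous fun p : D z × D z => h.form p.1 p.2 := by
  -- `D z` carries a topology but no chosen norm. Transporting its dual to that of the normed space
  -- `F` makes evaluation jointly continuous.
  have hc : Continuous fun η : D z =>
      ContinuousLinearMap.precomp ℂ (e.symm : F →L[ℂ] D z) (h.toDual z η) :=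
    (ContinuousLinearMap.continuous _).comp (h.toDual z).continuous
  have : Continuous fun p : D z × D z =>
      ContinuousLinearMap.precomp ℂ (e.symm : F →L[ℂ] D z) (h.toDual z p.2) (e p.1) :=
    (hc.comp continuous_snd).clm_apply (e.continuous.comp continuous_fst)
  refine this.congr fun p => ?_
  simp [HermitianForm.form]

/-! ### Feature maps and pull-backs of the universal kernel -/

namespace ReproducingKernel

variable {Z : Type*} {D : Z → Type*}
  [∀ z, AddCommGroup (D z)] [∀ z, Module ℂ (D z)] [∀ z, TopologicalSpace (D z)]
  {h : HermitianForm D} (K : ReproducingKernel h)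

theorem eq_of_op_eq {K L : ReproducingKernel h} (hKL : K.op = L.op) : K = L := by
  cases K
  cases L
  cases hKL
  rfl

/-- The map `ξ ↦ K_ξ` is continuous on normable fibres. -/
theorem continuous_feature {F : Type*} [NormedAddCommGroup F] [NormedSpace ℂ F] (s : Z)
    (e : D s ≃L[ℂ] F) : Continuous (K.feature s) := by
  have hcomp : Continuous ((K.feature s).comp (e.symm : F ≃ₗ[ℂ] D s).toLinearMap) := by
    refine continuous_of_continuousAt_zero
      ((K.feature s).comp (e.symm : F ≃ₗ[ℂ] D s).toLinearMap) ?_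
    -- The norm is the square root of a continuous function vanishing at `0`; by linearity,
    -- continuity at `0` suffices.
    have hn : ∀ x : F, ‖K.feature s (e.symm x)‖
        = √(h.form (K.op s s (e.symm x)) (e.symm x)).re := by
      intro x
      rw [← K.inner_feature, norm_eq_sqrt_re_inner (𝕜 := ℂ)]
      rfl
    have hc : Continuous fun x : F => √(h.form (K.op s s (e.symm x)) (e.symm x)).re :=
      Real.continuous_sqrt.comp (Complex.continuous_re.comp ((h.continuous_form e).comp
        (((K.op s s).continuous.comp e.symm.continuous).prodMk e.symm.continuous)))
    have h0 := hc.tendsto 0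
    simp only [map_zero, h.form_zero_left, Complex.zero_re, Real.sqrt_zero] at h0
    rw [ContinuousAt, map_zero, tendsto_zero_iff_norm_tendsto_zero]
    exact h0.congr fun x => (hn x).symm
  refine (hcomp.comp e.continuous).congr fun ξ => ?_
  simp

variable {H : Type*} [NormedAddCommGroup H] [InnerProductSpace ℂ H]

/-- The homomorphism into the tautological bundle defined by a family of bounded linear maps into
a Hilbert space; the base map is given by the closures of their ranges. -/
noncomputable def _root_.BundleHom.ofFeature (φ : ∀ s, D s →L[ℂ] H) :
    BundleHom D (Tautological H) where
  base s := (LinearMap.range (φ s : D s →ₗ[ℂ] H)).closure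
  fiber s := (φ s).codRestrict _ fun ξ => subset_closure ⟨ξ, rfl⟩

/-- A kernel with a feature map into a Hilbert space is a pull-back of the universal kernel. -/
theorem eq_pullback_ofFeature [CompleteSpace H] (φ : ∀ s, D s →L[ℂ] H)
    (hφ : ∀ (s t : Z) (ξ : D s) (η : D t),
      inner ℂ (φ s ξ) (φ t η) = h.form (K.op s t η) ξ) :
    K = (universalKernel H).pullback h (BundleHom.ofFeature φ) := by
  refine eq_of_op_eq (funext₂ fun s t => ContinuousLinearMap.ext fun η => ?_)
  rw [← sub_eq_zero]
  refine h.eq_zero_of_form _ fun ξ => ?_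
  have key : h.form (((universalKernel H).pullback h (BundleHom.ofFeature φ)).op s t η) ξ
      = h.form (K.op s t η) ξ := by
    -- `form_adjoint` expects the adjoint in the second slot, so the arguments are swapped by
    -- conjugation and swapped back afterwards.
    rw [← h.conj_form]
    change conj (h.form ξ (h.adjoint (tautologicalForm H) ((BundleHom.ofFeature φ).fiber s) _)) = _
    rw [h.form_adjoint, HermitianForm.conj_form, ← hφ]
    change inner ℂ ((BundleHom.ofFeature φ).fiber s ξ)
      (((BundleHom.ofFeature φ).base s).toSubmodule.orthogonalProjectionOnto (φ t η)) = _
    rw [Submodule.coe_inner]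
    -- The left vector lies in the subspace projected onto, so the projection does not affect the
    -- inner product.
    exact Submodule.inner_orthogonalProjectionOnto_eq_of_mem_left
      ((BundleHom.ofFeature φ).fiber s ξ) (φ t η)
  rw [sub_eq_add_neg, ← neg_one_smul ℂ, h.form_add_left, h.form_smul_left, key]
  ring

end ReproducingKernel

/-! ### Separable Hilbert spaces inside `ℓ²(ℕ)` -/

/-- An orthonormal set in a separable inner product space is countable. -/
theorem Orthonormal.countable_of_separableSpace {H : Type*} [NormedAddCommGroup H]
    [InnerProductSpace ℂ H] [TopologicalSpace.SeparableSpace H] {ι : Type*} {v : ι → H}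
    (hv : Orthonormal ℂ v) : Countable ι := by
  -- Distinct orthonormal vectors are `√2 ≥ 1/2 + 1/2` apart, and a separable space has only
  -- countably many disjoint nonempty open sets.
  have hd : Pairwise (Function.onFun Disjoint fun i => Metric.ball (v i) (1 / 2)) := by
    intro i j hij
    refine Metric.ball_disjoint_ball ?_
    have h2 : ‖v i - v j‖ ^ 2 = 2 := by
      rw [norm_sub_sq (𝕜 := ℂ), hv.2 hij, hv.1, hv.1]
      norm_num
    rw [dist_eq_norm]
    nlinarith [norm_nonneg (v i - v j)]
  exact hd.countable_of_isOpen_disjoint (fun i => Metric.isOpen_ball)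
    fun i => ⟨v i, Metric.mem_ball_self (by norm_num)⟩

/-- A separable Hilbert space embeds isometrically into `ℓ²(ℕ)`. -/
theorem exists_linearIsometry_l2 (H : Type*) [NormedAddCommGroup H] [InnerProductSpace ℂ H]
    [CompleteSpace H] [TopologicalSpace.SeparableSpace H] :
    Nonempty (H →ₗᵢ[ℂ] lp (fun _ : ℕ => ℂ) 2) := by
  obtain ⟨w, b, -⟩ := exists_hilbertBasis ℂ H
  have := b.orthonormal.countable_of_separableSpace
  -- An injection, not a bijection, also covers finite dimension; the isometry need not be onto.
  obtain ⟨f, hf⟩ := exists_injective_nat w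
  have ho := (HilbertBasis.ofRepr (LinearIsometryEquiv.refl ℂ (lp (fun _ : ℕ => ℂ) 2))).orthonormal
  -- Coordinates in `b` map `H` onto `ℓ²(w)`, and the standard basis vectors with indices in the
  -- range of `f` embed `ℓ²(w)` into `ℓ²(ℕ)`.
  exact ⟨((ho.comp f hf).orthogonalFamily.linearIsometry).comp b.repr.toLinearIsometry⟩

theorem theorem6p2
    -- `Z` is a smooth real Banach manifold
    {B : Type*} [NormedAddCommGroup B] [NormedSpace ℝ B] [CompleteSpace B]
    {Z : Type*} [TopologicalSpace Z] [ChartedSpace B Z] [IsManifold 𝓘(ℝ, B) ∞ Z]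
    -- `D` is a smooth complex vector bundle over `Z` with Banach fibre `F`
    {F : Type*} [NormedAddCommGroup F] [NormedSpace ℂ F] [CompleteSpace F]
    {D : Z → Type*} [∀ z, AddCommGroup (D z)] [∀ z, Module ℂ (D z)]
    [TopologicalSpace (TotalSpace F D)] [∀ z, TopologicalSpace (D z)]
    [FiberBundle F D] [VectorBundle ℂ F D] [ContMDiffVectorBundle ∞ F D 𝓘(ℝ, B)]
    (h : HermitianStructure B F D) (K : ReproducingKernel h.toHermitianForm) :
    (∃ Δ : BundleHom D (Tautological K.RKHS),
      (∀ s, Δ.base s = (LinearMap.range (K.feature s)).closure) ∧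
      (∀ (s : Z) (ξ : D s), (Δ.fiber s ξ : K.RKHS) = K.feature s ξ) ∧
      K = (universalKernel K.RKHS).pullback h.toHermitianForm Δ) ∧
    -- classical scalar kernels with separable reproducing kernel Hilbert space
    (∀ (X : Type*) (k : X → X → ℂ) (hk : IsPositiveDefiniteKernel k),
      TopologicalSpace.SeparableSpace hk.toReproducingKernel.RKHS →
      ∃ Δ : BundleHom (fun _ : X => ℂ) (Tautological (lp (fun _ : ℕ => ℂ) 2)),
        hk.toReproducingKernel
          = (universalKernel (lp (fun _ : ℕ => ℂ) 2)).pullback (trivialLineForm X) Δ) := by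
  refine ⟨?_, fun X k hk hsep => ?_⟩
  -- A local trivialization at `s` identifies the fibre with the Banach space `F`, as the continuity
  -- argument requires.
  · let φ : ∀ s, D s →L[ℂ] K.RKHS := fun s =>
      ⟨K.feature s, K.continuous_feature s
        ((trivializationAt F D s).continuousLinearEquivAt ℂ s (mem_baseSet_trivializationAt F D s))⟩
    exact ⟨BundleHom.ofFeature φ, fun s => rfl, fun s ξ => rfl,
      K.eq_pullback_ofFeature φ K.inner_feature⟩
  · obtain ⟨U⟩ := exists_linearIsometry_l2 hk.toReproducingKernel.RKHS
    let φ : X → ℂ →L[ℂ] lp (fun _ : ℕ => ℂ) 2 := fun s =>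
      U.toContinuousLinearMap.comp ⟨hk.toReproducingKernel.feature s,
        hk.toReproducingKernel.continuous_feature s (ContinuousLinearEquiv.refl ℂ ℂ)⟩
    refine ⟨BundleHom.ofFeature φ, hk.toReproducingKernel.eq_pullback_ofFeature φ
      fun s t ξ η => ?_⟩
    exact (U.inner_map_map _ _).trans (hk.toReproducingKernel.inner_feature s t ξ η)
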